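/- Let $p$ be a prime, let $K$ be a field of characteristic $p$, let $\delta\colon K\to K$ be a derivation, and let $F=\mathrm{Const}(\delta)=\{a\in K : \delta(a)=0\}$. Let $K[t;\delta]$ be the differential polynomial ring, i.e. the ring of polynomials $\sum_i a_it^i$ ($a_i\in K$) with termwise addition and the multiplication determined by $ta=at+\delta(a)$ for $a\in K$. Assume that $\delta$, as an $F$-linear endomorphism of $K$, has minimal polynomial $g(t)=t^p-t\in F[t]$. Let $d\in K\setminus F$ and $f(t)=t^p-t-d\in K[t;\delta]$. Let $(K,\delta,d)=K[t;\delta]/K[t;\delta]f$ be the set $\{h\in K[t;\delta] : \deg h<p\}$ with the addition of $K[t;\delta]$ and the multiplication $h\circ k = hk \bmod_r f$, where $hk\bmod_r f$ is the remainder $r$ of right division by $f$, that is, the unique $r$ with $\deg r<p$ and $hk=qf+r$ for some $q\in K[t;\delta]$. The elements of $K$ are viewed in $(K,\delta,d)$ as the constant polynomials. Then $A=(K,\delta,d)$ is a unital algebra over $F$ that is not associative, it has dimension $p^2$ over $F$, and it is a division algebra: $A\neq 0$ and for every nonzero $a\in A$ the maps $x\mapsto ax$ and $x\mapsto xa$ are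 bijective. With $[x,y,z]=(xy)z-x(yz)$, its left nucleus $\{x : [x,A,A]=0\}$ and its middle nucleus $\{x : [A,x,A]=0\}$ are both equal to $K$, and its right nucleus $\{x : [A,A,x]=0\}$ contains $K$. The group of $F$-algebra automorphisms of $A$ has a cyclic subgroup of order $p$ all of whose elements fix every element of $K$. -/

import Mathlib

open Polynomial

universe u

noncomputable section

/-- The field of constants `Const(δ) = {a ∈ K | δ(a) = 0}` of a derivation `δ` of a field `K`. -/
def derivConst {K : Type u} [Field K] (δ : Derivation ℤ K K) : Subfield K where
  carrier := {a | δ a = 0}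
  mul_mem' {a b} ha hb := by
    simp only [Set.mem_ofPred_eq] at ha hb ⊢
    simp [ha, hb]
  one_mem' := δ.map_one_eq_zero
  add_mem' {a b} ha hb := by
    simp only [Set.mem_ofPred_eq] at ha hb ⊢
    simp [ha, hb]
  zero_mem' := map_zero δ
  neg_mem' {a} ha := by
    simp only [Set.mem_ofPred_eq] at ha ⊢
    simp [ha]
  inv_mem' a ha := by
    simp only [Set.mem_ofPred_eq] at ha ⊢
    simp [Derivation.leibniz_inv, ha]

/-- A derivation `δ` of `K`, regarded as a linear endomorphism of `K` over its constants. -/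
def derivEnd {K : Type u} [Field K] (δ : Derivation ℤ K K) :
    Module.End (derivConst δ) K where
  toFun := δ
  map_add' := map_add δ
  map_smul' c a := by
    have hc : δ (c : K) = 0 := c.2
    simp [Subfield.smul_def, hc]

/-! ### Differential polynomial rings -/

/-- The differential polynomial ring `K[t;δ]`. Its elements are the polynomials `∑ aᵢ tⁱ` with
coefficients on the left; the product is the one determined by `t a = a t + δ(a)`. -/
def DiffPoly {K : Type u} [Field K] (_δ : Derivation ℤ K K) : Type u := K[X]

namespace DiffPoly

variable {K : Type u} [Field K] (δ : Derivation ℤ K K)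

instance : AddCommGroup (DiffPoly δ) := inferInstanceAs (AddCommGroup K[X])

instance : Module K (DiffPoly δ) := inferInstanceAs (Module K K[X])

/-- `∑ aᵢ tⁱ ↦ ∑ δ(aᵢ) tⁱ`. -/
def coeffDeriv : K[X] →+ K[X] where
  toFun g := ∑ i ∈ g.support, monomial i (δ (g.coeff i))
  map_zero' := by simp
  map_add' f g := by
    have key : ∀ g : K[X], ∀ n,
        (∑ i ∈ g.support, monomial i (δ (g.coeff i))).coeff n = δ (g.coeff n) := by
      intro g n
      simp only [finsetSum_coeff, coeff_monomial, Finset.sum_ite_eq']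
      split_ifs with h
      · rfl
      · rw [notMem_support_iff.mp h, map_zero]
    ext n
    rw [coeff_add, key, key, key, coeff_add, map_add]

theorem coeff_coeffDeriv (g : K[X]) (n : ℕ) :
    (coeffDeriv δ g).coeff n = δ (g.coeff n) := by
  simp only [coeffDeriv, AddMonoidHom.coe_mk, ZeroHom.coe_mk, finsetSum_coeff, coeff_monomial,
    Finset.sum_ite_eq']
  split_ifs with h
  · rfl
  · rw [notMem_support_iff.mp h, map_zero]

/-- Left multiplication by `t` in `K[t;δ]`: `t (∑ aᵢ tⁱ) = ∑ aᵢ tⁱ⁺¹ + ∑ δ(aᵢ) tⁱ`. -/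
def tMul : Module.End ℤ K[X] :=
  (AddMonoidHom.mulLeft (X : K[X]) + coeffDeriv δ).toIntLinearMap

theorem tMul_apply (g : K[X]) : tMul δ g = X * g + coeffDeriv δ g := rfl

/-- The product of `K[t;δ]`: `(∑ aᵢ tⁱ) g = ∑ aᵢ (t (t ⋯ (t g)))`, with `i` factors `t`. -/
def mulAux (f g : K[X]) : K[X] := f.sum fun i a => C a * (tMul δ ^ i) g

theorem mulAux_add_left (f₁ f₂ g : K[X]) :
    mulAux δ (f₁ + f₂) g = mulAux δ f₁ g + mulAux δ f₂ g := by
  unfold mulAux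
  exact sum_add_index _ _ _ (by simp) (by intros; simp [add_mul])

theorem mulAux_add_right (f g₁ g₂ : K[X]) :
    mulAux δ f (g₁ + g₂) = mulAux δ f g₁ + mulAux δ f g₂ := by
  simp [mulAux, Polynomial.sum_def, mul_add, Finset.sum_add_distrib]

theorem mulAux_monomial (n : ℕ) (a : K) (g : K[X]) :
    mulAux δ (monomial n a) g = C a * (tMul δ ^ n) g := by
  simp [mulAux, sum_monomial_index]

theorem mulAux_C_mul (a : K) (f g : K[X]) :
    mulAux δ (C a * f) g = C a * mulAux δ f g := by
  induction f using Polynomial.induction_on' with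
  | add p q hp hq => rw [mul_add, mulAux_add_left, hp, hq, mulAux_add_left, mul_add]
  | monomial n b => rw [C_mul_monomial, mulAux_monomial, mulAux_monomial, C_mul, mul_assoc]

theorem tMul_C_mul (a : K) (g : K[X]) :
    tMul δ (C a * g) = C a * tMul δ g + C (δ a) * g := by
  have h : coeffDeriv δ (C a * g) = C a * coeffDeriv δ g + C (δ a) * g := by
    ext n
    simp only [coeff_coeffDeriv, coeff_C_mul, coeff_add, Derivation.leibniz, smul_eq_mul]
    ring
  rw [tMul_apply, tMul_apply, h]
  ring

theorem mulAux_tMul (f g : K[X]) : mulAux δ (tMul δ f) g = tMul δ (mulAux δ f g) := by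
  induction f using Polynomial.induction_on' with
  | add p q hp hq => rw [map_add, mulAux_add_left, hp, hq, mulAux_add_left, map_add]
  | monomial n b =>
    have h : tMul δ (monomial n b) = monomial (n + 1) b + monomial n (δ b) := by
      rw [tMul_apply, X_mul_monomial]
      congr 1
      ext m
      rw [coeff_coeffDeriv, coeff_monomial, coeff_monomial]
      split_ifs <;> simp
    rw [h, mulAux_add_left, mulAux_monomial, mulAux_monomial, mulAux_monomial, tMul_C_mul,
      pow_succ', Module.End.mul_apply]

theorem mulAux_tMul_pow (n : ℕ) (f g : K[X]) :
    mulAux δ ((tMul δ ^ n) f) g = (tMul δ ^ n) (mulAux δ f g) := by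
  induction n with
  | zero => simp
  | succ n ih => rw [pow_succ', Module.End.mul_apply, mulAux_tMul, ih, Module.End.mul_apply]

theorem mulAux_assoc (f g h : K[X]) :
    mulAux δ (mulAux δ f g) h = mulAux δ f (mulAux δ g h) := by
  induction f using Polynomial.induction_on' with
  | add p q hp hq => simp only [mulAux_add_left, hp, hq]
  | monomial n b => rw [mulAux_monomial, mulAux_monomial, mulAux_C_mul, mulAux_tMul_pow]

theorem mulAux_one_left (g : K[X]) : mulAux δ 1 g = g := by
  rw [← monomial_zero_one, mulAux_monomial]
  simp

theorem tMul_X_pow (n : ℕ) : tMul δ (X ^ n) = X ^ (n + 1) := by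
  rw [tMul_apply, pow_succ']
  have : coeffDeriv δ (X ^ n) = 0 := by
    ext m
    rw [coeff_coeffDeriv, coeff_X_pow]
    split_ifs <;> simp
  rw [this, add_zero]

theorem tMul_pow_one (n : ℕ) : (tMul δ ^ n) 1 = X ^ n := by
  induction n with
  | zero => simp
  | succ n ih => rw [pow_succ', Module.End.mul_apply, ih, tMul_X_pow]

theorem mulAux_one_right (f : K[X]) : mulAux δ f 1 = f := by
  induction f using Polynomial.induction_on' with
  | add p q hp hq => rw [mulAux_add_left, hp, hq]
  | monomial n b => rw [mulAux_monomial, tMul_pow_one, C_mul_X_pow_eq_monomial]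

theorem mulAux_zero_left (g : K[X]) : mulAux δ 0 g = 0 := by simp [mulAux]

theorem mulAux_zero_right (f : K[X]) : mulAux δ f 0 = 0 := by
  simp [mulAux, Polynomial.sum_def]

instance : Ring (DiffPoly δ) :=
  { (inferInstance : AddCommGroup (DiffPoly δ)) with
    mul := mulAux δ
    one := (1 : K[X])
    left_distrib := mulAux_add_right δ
    right_distrib := mulAux_add_left δ
    zero_mul := mulAux_zero_left δ
    mul_zero := mulAux_zero_right δ
    mul_assoc := mulAux_assoc δ
    one_mul := mulAux_one_left δ
    mul_one := mulAux_one_right δ }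

variable {δ}

/-- The underlying polynomial `∑ aᵢ Xⁱ` of `∑ aᵢ tⁱ`. -/
def toPoly : DiffPoly δ ≃ₗ[K] K[X] := LinearEquiv.refl K K[X]

theorem toPoly_mul (f g : DiffPoly δ) : toPoly (f * g) = mulAux δ (toPoly f) (toPoly g) := rfl

theorem toPoly_one : toPoly (1 : DiffPoly δ) = 1 := rfl

/-- The degree of a differential polynomial (with the value `0` at `0`). -/
def natDegree (f : DiffPoly δ) : ℕ := (toPoly f).natDegree

variable (δ)

/-- The indeterminate `t` of `K[t;δ]`. -/
def t : DiffPoly δ := toPoly.symm X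

/-- The constant polynomial `a` in `K[t;δ]`. -/
def const (a : K) : DiffPoly δ := toPoly.symm (C a)

/-- The defining relation `t a = a t + δ(a)` of `K[t;δ]`. -/
theorem t_mul_const (a : K) : t δ * const δ a = const δ a * t δ + const δ (δ a) := by
  apply toPoly.injective
  rw [map_add, toPoly_mul, toPoly_mul]
  simp only [t, const, LinearEquiv.apply_symm_apply]
  rw [← monomial_zero_left (a := a), mulAux_monomial, ← monomial_one_one_eq_X, mulAux_monomial]
  rw [monomial_zero_left, pow_one, ← mul_one (C a), tMul_C_mul, ← pow_zero X, tMul_X_pow]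
  simp [monomial_one_one_eq_X]

/-- A differential polynomial is the sum of the terms `aᵢ tⁱ`. -/
theorem eq_sum (f : DiffPoly δ) :
    f = ∑ i ∈ (toPoly f).support, const δ ((toPoly f).coeff i) * t δ ^ i := by
  have ht : ∀ n : ℕ, toPoly (t δ ^ n) = X ^ n := by
    intro n
    induction n with
    | zero => rfl
    | succ n ih =>
      rw [pow_succ', toPoly_mul, ih, t, LinearEquiv.apply_symm_apply, ← monomial_one_one_eq_X,
        mulAux_monomial, monomial_one_one_eq_X, pow_one, tMul_X_pow, C_1, one_mul]
  apply toPoly.injective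
  rw [map_sum]
  conv_lhs => rw [(toPoly f).as_sum_support_C_mul_X_pow]
  refine Finset.sum_congr rfl fun i _ => ?_
  rw [toPoly_mul, ht, const, LinearEquiv.apply_symm_apply, ← monomial_zero_left, mulAux_monomial]
  simp

theorem smul_eq_const_mul (a : K) (f : DiffPoly δ) : a • f = const δ a * f := by
  apply toPoly.injective
  rw [map_smul, toPoly_mul, const, LinearEquiv.apply_symm_apply, ← monomial_zero_left,
    mulAux_monomial, smul_eq_C_mul]
  simp

/-! ### Right division with remainder -/

theorem degree_tMul_sub_lt (n : ℕ) (g : K[X]) (hg : g ≠ 0) :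
    ((tMul δ ^ n) g - X ^ n * g).degree < n + g.degree := by
  have hd : ∀ h : K[X], (coeffDeriv δ h).degree ≤ h.degree := by
    intro h
    rw [degree_le_iff_coeff_zero]
    intro m hm
    rw [coeff_coeffDeriv, coeff_eq_zero_of_degree_lt hm, map_zero]
  have hb : g.degree ≠ ⊥ := fun h => hg (degree_eq_bot.mp h)
  obtain ⟨k, hk⟩ : ∃ k : ℕ, g.degree = k := ⟨_, degree_eq_natDegree hg⟩
  induction n with
  | zero =>
    simp [hk]
  | succ n ih =>
    have e : (tMul δ ^ (n + 1)) g - X ^ (n + 1) * g =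
        X * ((tMul δ ^ n) g - X ^ n * g) + coeffDeriv δ ((tMul δ ^ n) g) := by
      rw [pow_succ', Module.End.mul_apply, tMul_apply]
      ring
    rw [e]
    have h2 : ((tMul δ ^ n) g).degree ≤ n + g.degree := by
      have : (tMul δ ^ n) g = ((tMul δ ^ n) g - X ^ n * g) + X ^ n * g := by ring
      rw [this]
      refine (degree_add_le _ _).trans (max_le ih.le ?_)
      rw [degree_mul, degree_X_pow]
    have h3 : ((n : WithBot ℕ) + g.degree) < ((n + 1 : ℕ) : WithBot ℕ) + g.degree := by
      rw [hk]
      norm_cast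
      omega
    refine (degree_add_le _ _).trans_lt (max_lt ?_ (((hd _).trans h2).trans_lt h3))
    rw [degree_mul, degree_X]
    by_cases h0 : (tMul δ ^ n) g - X ^ n * g = 0
    · rw [h0, degree_zero, WithBot.add_bot, hk]
      exact WithBot.bot_lt_coe _
    · rw [degree_eq_natDegree h0, hk] at ih ⊢
      norm_cast at ih ⊢
      omega

theorem degree_mulAux_sub_lt (f g : K[X]) (hf : f ≠ 0) (hg : g ≠ 0) :
    (mulAux δ f g - f * g).degree < (f * g).degree := by
  have e : mulAux δ f g - f * g =
      ∑ i ∈ f.support, C (f.coeff i) * ((tMul δ ^ i) g - X ^ i * g) := by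
    conv_lhs => rw [mulAux, Polynomial.sum_def]
    conv_lhs => enter [2, 1]; rw [f.as_sum_support_C_mul_X_pow]
    rw [Finset.sum_mul, ← Finset.sum_sub_distrib]
    exact Finset.sum_congr rfl fun i _ => by ring
  have hfg : (⊥ : WithBot ℕ) < (f * g).degree := bot_lt_iff_ne_bot.mpr fun h =>
    mul_ne_zero hf hg (degree_eq_bot.mp h)
  rw [e]
  refine (degree_sum_le _ _).trans_lt ((Finset.sup_lt_iff hfg).mpr fun i hi => ?_)
  rw [degree_C_mul (mem_support_iff.mp hi)]
  refine (degree_tMul_sub_lt δ i g hg).trans_le ?_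
  rw [degree_mul]
  gcongr
  exact le_degree_of_mem_supp _ hi

theorem degree_mulAux (f g : K[X]) : (mulAux δ f g).degree = f.degree + g.degree := by
  by_cases hf : f = 0
  · simp [hf, mulAux]
  by_cases hg : g = 0
  · simp [hg, mulAux, Polynomial.sum_def]
  have : mulAux δ f g = f * g + (mulAux δ f g - f * g) := by ring
  rw [this, degree_add_eq_left_of_degree_lt (degree_mulAux_sub_lt δ f g hf hg), degree_mul]

/-- The left `K`-space of differential polynomials of degree less than `m`. -/
def degLT (m : ℕ) : Submodule K (DiffPoly δ) :=
  (degreeLT K m).comap (toPoly : DiffPoly δ ≃ₗ[K] K[X]).toLinearMap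

variable {δ}

theorem mem_degLT {m : ℕ} {g : DiffPoly δ} : g ∈ degLT δ m ↔ (toPoly g).degree < m := by
  simp [degLT, mem_degreeLT]

/-- Existence in the right division algorithm: `g = q f + r` with `deg r < deg f`. -/
theorem exists_rem (f : DiffPoly δ) (hf : f ≠ 0) (g : DiffPoly δ) :
    ∃ r : degLT δ (natDegree f), ∃ q : DiffPoly δ, g = q * f + r := by
  have hf' : toPoly f ≠ 0 := fun h => hf (toPoly.map_eq_zero_iff.mp h)
  have main : ∀ n : ℕ, ∀ g : DiffPoly δ, (toPoly g).degree < n →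
      ∃ r : degLT δ (natDegree f), ∃ q : DiffPoly δ, g = q * f + r := by
    intro n
    induction n with
    | zero =>
      intro g hg
      refine ⟨⟨g, mem_degLT.mpr (hg.trans_le ?_)⟩, 0, by simp⟩
      exact_mod_cast Nat.zero_le _
    | succ n ih =>
      intro g hg
      by_cases hlt : (toPoly g).degree < (natDegree f : ℕ)
      · exact ⟨⟨g, mem_degLT.mpr hlt⟩, 0, by simp⟩
      have hg' : toPoly g ≠ 0 := by
        intro h
        rw [h, degree_zero] at hlt
        exact hlt (WithBot.bot_lt_coe _)
      have hle : (toPoly f).natDegree ≤ (toPoly g).natDegree := by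
        rw [degree_eq_natDegree hg'] at hlt
        exact not_lt.mp (by exact_mod_cast hlt)
      set a := (toPoly g).leadingCoeff / (toPoly f).leadingCoeff with ha
      have ha0 : a ≠ 0 := div_ne_zero (leadingCoeff_ne_zero.mpr hg')
        (leadingCoeff_ne_zero.mpr hf')
      set q : K[X] := C a * X ^ ((toPoly g).natDegree - (toPoly f).natDegree) with hq
      have hq0 : q ≠ 0 := mul_ne_zero (C_ne_zero.mpr ha0) (pow_ne_zero _ X_ne_zero)
      have hdeg : (q * toPoly f).degree = (toPoly g).degree := by
        rw [degree_mul, hq, degree_C_mul_X_pow _ ha0, degree_eq_natDegree hf',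
          degree_eq_natDegree hg']
        norm_cast
        omega
      have hlc : (toPoly g).leadingCoeff = (q * toPoly f).leadingCoeff := by
        rw [leadingCoeff_mul, hq, leadingCoeff_C_mul_X_pow, ha,
          div_mul_cancel₀ _ (leadingCoeff_ne_zero.mpr hf')]
      have h1 : (toPoly g - q * toPoly f).degree < (toPoly g).degree :=
        degree_sub_lt_left hdeg.symm hg' hlc
      have h2 := degree_mulAux_sub_lt δ q (toPoly f) hq0 hf'
      rw [hdeg] at h2
      have h3 : (toPoly (g - toPoly.symm q * f)).degree < n := by
        have e : toPoly (g - toPoly.symm q * f) =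
            (toPoly g - q * toPoly f) - (mulAux δ q (toPoly f) - q * toPoly f) := by
          rw [map_sub, toPoly_mul, LinearEquiv.apply_symm_apply]
          ring
        have h4 : (toPoly (g - toPoly.symm q * f)).degree < (toPoly g).degree := by
          rw [e]
          exact (degree_sub_le _ _).trans_lt (max_lt h1 h2)
        refine h4.trans_le ?_
        rw [degree_eq_natDegree hg'] at hg ⊢
        norm_cast at hg ⊢
        omega
      obtain ⟨r, q', h⟩ := ih _ h3
      refine ⟨r, toPoly.symm q + q', ?_⟩
      rw [add_mul, add_assoc, ← h]
      abel
  exact main ((toPoly g).natDegree + 1) g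
    (degree_le_natDegree.trans_lt (by exact_mod_cast Nat.lt_succ_self _))

/-- Uniqueness of the remainder in the right division algorithm. -/
theorem rem_unique {f g q q' : DiffPoly δ} {r r' : degLT δ (natDegree f)} (hf : f ≠ 0)
    (h : g = q * f + r) (h' : g = q' * f + r') : r = r' := by
  have hf' : toPoly f ≠ 0 := fun h => hf (toPoly.map_eq_zero_iff.mp h)
  have e : (q' - q) * f = ((r - r' : degLT δ (natDegree f)) : DiffPoly δ) := by
    have := h.symm.trans h'
    rw [sub_mul, Submodule.coe_sub, sub_eq_sub_iff_add_eq_add, ← this]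
    abel
  have hlt := mem_degLT.mp (r - r').2
  rw [← e, toPoly_mul, degree_mulAux, degree_eq_natDegree hf'] at hlt
  have hq : toPoly (q' - q) = 0 := by
    by_contra h0
    rw [degree_eq_natDegree h0] at hlt
    norm_cast at hlt
    unfold natDegree at hlt
    omega
  have hq0 : q' - q = 0 := toPoly.map_eq_zero_iff.mp hq
  rw [hq0, zero_mul] at e
  exact sub_eq_zero.mp (Subtype.ext e.symm)

open Classical in
/-- The remainder `g mod_r f` of the right division `g = q f + r`, `deg r < deg f`
(and `0` if `f = 0`). -/
def modr (f g : DiffPoly δ) : degLT δ (natDegree f) :=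
  if hf : f ≠ 0 then (exists_rem f hf g).choose else 0

theorem modr_spec (f g : DiffPoly δ) (hf : f ≠ 0) : ∃ q, g = q * f + modr f g := by
  rw [modr, dif_pos hf]
  exact (exists_rem f hf g).choose_spec

theorem modr_add (f g h : DiffPoly δ) : modr f (g + h) = modr f g + modr f h := by
  by_cases hf : f = 0
  · simp [modr, hf]
  obtain ⟨q₁, h₁⟩ := modr_spec f g hf
  obtain ⟨q₂, h₂⟩ := modr_spec f h hf
  obtain ⟨q₃, h₃⟩ := modr_spec f (g + h) hf
  refine rem_unique hf h₃ (q' := q₁ + q₂) ?_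
  rw [Submodule.coe_add, add_mul]
  nth_rewrite 1 [h₁, h₂]
  abel

theorem modr_smul (f : DiffPoly δ) (a : K) (g : DiffPoly δ) :
    modr f (a • g) = a • modr f g := by
  by_cases hf : f = 0
  · simp [modr, hf]
  obtain ⟨q₁, h₁⟩ := modr_spec f g hf
  obtain ⟨q₂, h₂⟩ := modr_spec f (a • g) hf
  refine rem_unique hf h₂ (q' := a • q₁) ?_
  rw [Submodule.coe_smul, smul_eq_const_mul, smul_eq_const_mul, smul_eq_const_mul, mul_assoc,
    ← mul_add, ← h₁]

theorem modr_coe (f : DiffPoly δ) (r : degLT δ (natDegree f)) : modr f (r : DiffPoly δ) = r := by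
  by_cases hf : f = 0
  · subst hf
    have h0 : ∀ s : degLT δ (natDegree (0 : DiffPoly δ)), s = 0 := by
      intro s
      have hz : ((natDegree (0 : DiffPoly δ) : ℕ) : WithBot ℕ) = 0 := by simp [natDegree]
      have hs := (mem_degLT.mp s.2).trans_eq hz
      rw [Nat.WithBot.lt_zero_iff, degree_eq_bot] at hs
      exact Subtype.ext (toPoly.map_eq_zero_iff.mp hs)
    rw [h0 r, h0 (modr _ _)]
  obtain ⟨q, h⟩ := modr_spec f r hf
  exact rem_unique hf h (q' := 0) (by simp)

end DiffPoly

/-! ### Petit algebras -/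

/-- The Petit algebra `S_f = K[t;δ]/K[t;δ]f`: the differential polynomials of degree less than
`deg f`, with the multiplication `g ∘ h = g h mod_r f`. -/
def PetitAlgebra {K : Type u} [Field K] {δ : Derivation ℤ K K} (f : DiffPoly δ) : Type u :=
  DiffPoly.degLT δ f.natDegree

namespace PetitAlgebra

open DiffPoly

variable {K : Type u} [Field K] {δ : Derivation ℤ K K} (f : DiffPoly δ)

instance : AddCommGroup (PetitAlgebra f) :=
  inferInstanceAs (AddCommGroup (degLT δ (DiffPoly.natDegree f)))

/-- `S_f` is a left `K`-space, by multiplication in `K[t;δ]`; by restriction of scalars it is a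
vector space over every subfield of `K`. -/
instance : Module K (PetitAlgebra f) :=
  inferInstanceAs (Module K (degLT δ (DiffPoly.natDegree f)))

variable {f}

/-- The representative of degree less than `deg f`. -/
def rep : PetitAlgebra f →ₗ[K] DiffPoly δ := (degLT δ (DiffPoly.natDegree f)).subtype

variable (f)

/-- The remainder modulo `f`, as an element of `S_f`. -/
def mk : DiffPoly δ →ₗ[K] PetitAlgebra f where
  toFun g := modr f g
  map_add' := modr_add f
  map_smul' := modr_smul f

variable {f}

theorem mk_rep (x : PetitAlgebra f) : mk f (rep x) = x := modr_coe f x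

theorem rep_mk_one_or (f : DiffPoly δ) :
    rep (mk f 1) = 1 ∨ ∀ x : PetitAlgebra f, x = 0 := by
  by_cases h : DiffPoly.natDegree f = 0
  · right
    intro x
    have hz : ((DiffPoly.natDegree f : ℕ) : WithBot ℕ) = 0 := by simp [h]
    have hx := (mem_degLT.mp x.2).trans_eq hz
    rw [Nat.WithBot.lt_zero_iff, degree_eq_bot] at hx
    exact Subtype.ext (toPoly.map_eq_zero_iff.mp hx)
  · left
    have h1 : (1 : DiffPoly δ) ∈ degLT δ (DiffPoly.natDegree f) := by
      rw [mem_degLT, toPoly_one, degree_one]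
      exact_mod_cast Nat.pos_of_ne_zero h
    exact congrArg Subtype.val (modr_coe f ⟨1, h1⟩)

instance : NonAssocRing (PetitAlgebra f) :=
  { (inferInstance : AddCommGroup (PetitAlgebra f)) with
    mul := fun x y => mk f (rep x * rep y)
    one := mk f 1
    left_distrib := fun x y z => by
      change mk f (rep x * rep (y + z)) = mk f (rep x * rep y) + mk f (rep x * rep z)
      rw [map_add, mul_add, map_add]
    right_distrib := fun x y z => by
      change mk f (rep (x + y) * rep z) = mk f (rep x * rep z) + mk f (rep y * rep z)
      rw [map_add, add_mul, map_add]
    zero_mul := fun x => by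
      change mk f (rep 0 * rep x) = 0
      rw [map_zero, zero_mul, map_zero]
    mul_zero := fun x => by
      change mk f (rep x * rep 0) = 0
      rw [map_zero, mul_zero, map_zero]
    one_mul := fun x => by
      change mk f (rep (mk f 1) * rep x) = x
      rcases rep_mk_one_or f with h | h
      · rw [h, one_mul, mk_rep]
      · rw [h x, h (mk f _)]
    mul_one := fun x => by
      change mk f (rep x * rep (mk f 1)) = x
      rcases rep_mk_one_or f with h | h
      · rw [h, mul_one, mk_rep]
      · rw [h x, h (mk f _)] }

variable (f)

/-- The map sending `a ∈ K` to the constant polynomial `a` in `S_f`; its range is the copy of `K`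
contained in `S_f`. -/
def ofField : K →+* PetitAlgebra f where
  toFun a := mk f (const δ a)
  map_one' := rfl
  map_mul' a b := by
    change _ = mk f (rep _ * rep _)
    have h : ∀ c : K, mk f (const δ c) = c • mk f 1 := by
      intro c
      rw [← map_smul, smul_eq_const_mul, mul_one]
    rcases rep_mk_one_or f with h1 | h1
    · simp only [h, map_smul, h1]
      rw [smul_eq_const_mul δ a 1, mul_one, ← smul_eq_const_mul, map_smul, map_smul, mul_smul]
    · rw [h1 (mk f _), h1 (mk f (_ * _))]
  map_zero' := by
    have : const δ (0 : K) = 0 := by simp [const]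
    rw [this, map_zero]
  map_add' a b := by
    have : const δ (a + b) = const δ a + const δ b := by simp [const]
    rw [this, map_add]

end PetitAlgebra

/-! ### Nonassociative algebras -/

/-- The left nucleus of a nonassociative ring. -/
def leftNucleus (A : Type u) [NonAssocRing A] : Set A :=
  {x | ∀ y z : A, (x * y) * z - x * (y * z) = 0}

/-- The middle nucleus of a nonassociative ring. -/
def middleNucleus (A : Type u) [NonAssocRing A] : Set A :=
  {x | ∀ y z : A, (y * x) * z - y * (x * z) = 0}

/-- The right nucleus of a nonassociative ring. -/
def rightNucleus (A : Type u) [NonAssocRing A] : Set A :=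
  {x | ∀ y z : A, (y * z) * x - y * (z * x) = 0}

/-- A nonassociative ring is a division ring if it is nonzero and all left and right
multiplications by nonzero elements are bijective. -/
def IsNonassocDivision (A : Type u) [NonAssocRing A] : Prop :=
  Nontrivial A ∧ ∀ a : A, a ≠ 0 →
    Function.Bijective (fun x : A => a * x) ∧ Function.Bijective (fun x : A => x * a)

/-- The group of `F`-algebra automorphisms of a nonassociative `F`-algebra `A`: the multiplicative
`F`-linear bijections. -/
def nonassocAut (F A : Type u) [Field F] [NonAssocRing A] [Module F A] :
    Subgroup (A ≃ₗ[F] A) where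
  carrier := {φ | ∀ x y : A, φ (x * y) = φ x * φ y}
  mul_mem' {φ ψ} hφ hψ x y := by
    change φ (ψ (x * y)) = φ (ψ x) * φ (ψ y)
    rw [hψ, hφ]
  one_mem' x y := rfl
  inv_mem' {φ} hφ x y := by
    change φ.symm (x * y) = φ.symm x * φ.symm y
    apply φ.injective
    rw [hφ]
    simp

end

/-! Write `z = t ^ p - t`, so that `f = z - d`. In characteristic `p` one has `[t ^ p, a] = δ^[p]
a`, and `δ^[p] = δ`, so `z` is central (`commute_artinSchreier_zero`). Hence `f` commutes with `K`,
whereas `f t = t f + δ(d)` with `δ(d) ≠ 0`. Everything rests on these two facts.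

Division: a left ideal `I` containing `f` is stable under right multiplication by `d`, because `v d
= z v - v f`. The commutator of `w ∈ I` with `d` therefore lies in `I`. If `0 < deg w < p`, its
degree is exactly `deg w - 1`, with leading coefficient that of `w` times `deg w · δ(d)`. Descending
to degree `0` gives `I = ⊤` (`eq_top_of_artinSchreier_mem`). If `x y` were a left multiple of `f`
with `x, y` nonzero of degree below `p`, the class of `y` would generate the whole `p`-dimensional
quotient, although `x` annihilates it and so bounds the dimension by `deg x < p`
(`natDegree_le_of_span_eq_top`). Without zero divisors, finite dimension over `F` makes all
multiplications by nonzero elements bijective.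

Dimension: `X ^ p - X` splits with the distinct roots `0, …, p - 1`, so `K` is a sum of eigenspaces
of `δ`. A nonconstant `d` yields some `x` with `δ x = x`, and `1, x, …, x ^ (p - 1)` is an `F`-basis
of `K`. Thus `[A : F] = p [K : F] = p ^ 2`.

Nuclei: if `x y = q f + r`, then `[x, y, t]` is `- q δ(d)`, so its vanishing forces `q = 0`, that is
`deg x + deg y < p` (`degree_add_degree_lt_of_mul_gen`). Testing against `t ^ (p - 1)` leaves only
constants; associativity fails because `t` is not one.

Automorphisms: `t ↦ t + 1` preserves `t a = a t + δ(a)` and fixes `f`, so it descends to the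
quotient; its order is `p`. -/

/-! ### Derivations annihilated by `X ^ p - X` -/

section Derivation

variable {K : Type u} [Field K] {δ : Derivation ℤ K K}

theorem mem_derivConst {a : K} : a ∈ derivConst δ ↔ δ a = 0 := Iff.rfl

theorem derivEnd_apply (a : K) : derivEnd δ a = δ a := rfl

theorem Derivation.iterate_eq_of_aeval_derivEnd {p : ℕ}
    (h : aeval (derivEnd δ) (X ^ p - X : (derivConst δ)[X]) = 0) (a : K) : δ^[p] a = δ a := by
  have h1 := congrArg (fun φ : Module.End (derivConst δ) K => φ a) h
  simp only [map_sub, map_pow, aeval_X, LinearMap.sub_apply, LinearMap.zero_apply,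
    sub_eq_zero, Module.End.pow_apply] at h1
  exact h1

theorem Derivation.map_pow_of_eigen {x c : K} (hx : δ x = c * x) (n : ℕ) :
    δ (x ^ n) = n * c * x ^ n := by
  induction n with
  | zero => simp
  | succ n ih =>
    rw [pow_succ, Derivation.leibniz, ih, hx]
    simp only [smul_eq_mul]
    push_cast
    ring

/-- Both sides are monic of degree `p` and vanish at `0, …, p - 1`, the right side because Frobenius
fixes the prime field. Their difference has degree below `p` and `p` distinct roots. -/
theorem Lagrange.nodal_range_natCast {F : Type*} [Field F] (p : ℕ) [Fact p.Prime] [CharP F p] :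
    Lagrange.nodal (Finset.range p) (fun i : ℕ => (i : F)) = X ^ p - X := by
  have hp : 1 < p := (Fact.out : p.Prime).one_lt
  have hinj : Set.InjOn (fun i : ℕ => (i : F)) (Finset.range p) :=
    CharP.natCast_injOn_Iio F p |>.mono (by intro i hi; simpa using hi)
  have hm : (X ^ p - X : F[X]).Monic := monic_X_pow_sub (by simpa using hp)
  have hdeg : (X ^ p - X : F[X]).degree = p := by
    rw [degree_eq_natDegree hm.ne_zero, FiniteField.X_pow_card_sub_X_natDegree_eq F hp]
  have hdn : (Lagrange.nodal (Finset.range p) (fun i : ℕ => (i : F))).degree = p := by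
    rw [Lagrange.degree_nodal, Finset.card_range]
  refine Polynomial.eq_of_degree_sub_lt_of_eval_index_eq (Finset.range p) hinj ?_ ?_
  · rw [Finset.card_range, ← hdn]
    refine degree_sub_lt_left (hdn.trans hdeg.symm) (Lagrange.nodal_monic).ne_zero ?_
    rw [hm.leadingCoeff, Lagrange.nodal_monic.leadingCoeff]
  · intro i hi
    rw [Lagrange.eval_nodal_at_node hi]
    simp only [eval_sub, eval_pow, eval_X]
    rw [← frobenius_def p (i : F), map_natCast, sub_self]

variable (p : ℕ) [Fact p.Prime] [CharP K p]

/-- The Lagrange basis polynomials at the nodes `0, …, p - 1`, evaluated at `δ`, act as spectral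
projections: they sum to `1`, and `(X - i) b i` is a multiple of `X ^ p - X`, which annihilates `δ`.
-/
theorem Derivation.exists_eigen_decomposition
    (h : aeval (derivEnd δ) (X ^ p - X : (derivConst δ)[X]) = 0) (a : K) :
    ∃ g : ℕ → K, a = ∑ i ∈ Finset.range p, g i ∧ ∀ i ∈ Finset.range p, δ (g i) = i * g i := by
  have hp : 1 < p := (Fact.out : p.Prime).one_lt
  have hinj : Set.InjOn (fun i : ℕ => (i : derivConst δ)) (Finset.range p) :=
    CharP.natCast_injOn_Iio _ p |>.mono (by intro i hi; simpa using hi)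
  let b : ℕ → (derivConst δ)[X] := Lagrange.basis (Finset.range p) (fun i : ℕ => (i : derivConst δ))
  refine ⟨fun i => aeval (derivEnd δ) (b i) a, ?_, fun i hi => ?_⟩
  · have h1 := Lagrange.sum_basis hinj (Finset.nonempty_range_iff.mpr (by omega))
    have h2 := congrArg (fun q => aeval (derivEnd δ) q a) h1
    simpa [LinearMap.sum_apply] using h2.symm
  · have h1 : (X - C (i : derivConst δ)) * b i =
        C (Lagrange.nodalWeight (Finset.range p) (fun i : ℕ => (i : derivConst δ)) i) *
          (X ^ p - X) := by
      rw [← Lagrange.nodal_range_natCast, Lagrange.nodal_eq_mul_nodal_erase hi,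
        show b i = _ from Lagrange.basis_eq_prod_sub_inv_mul_nodal_div hi,
        Lagrange.nodal_erase_eq_nodal_div hi]
      ring
    have h2 := congrArg (fun q => aeval (derivEnd δ) q a) h1
    simp only [map_mul, h, mul_zero, LinearMap.zero_apply, Module.End.mul_apply, map_sub, aeval_X,
      _root_.map_natCast, LinearMap.sub_apply, sub_eq_zero] at h2
    rw [derivEnd_apply] at h2
    rw [h2, Module.End.natCast_apply, nsmul_eq_mul]

theorem Derivation.exists_eigenvector_one
    (h : aeval (derivEnd δ) (X ^ p - X : (derivConst δ)[X]) = 0) {d : K} (hd : δ d ≠ 0) :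
    ∃ x : K, x ≠ 0 ∧ δ x = x := by
  obtain ⟨g, hg, hgi⟩ := Derivation.exists_eigen_decomposition p h d
  obtain ⟨i, hi, hne⟩ : ∃ i ∈ Finset.range p, δ (g i) ≠ 0 := by
    by_contra! hc
    rw [hg, map_sum] at hd
    exact hd (Finset.sum_eq_zero hc)
  rw [hgi i hi] at hne
  have hi0 : (i : ZMod p) ≠ 0 := by
    intro h0
    have := congrArg (ZMod.castHom (dvd_refl p) K) h0
    rw [_root_.map_natCast, map_zero] at this
    exact left_ne_zero_of_mul hne this
  -- Raising an eigenvector to a power multiplies its eigenvalue by the exponent, so a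
  -- representative of the inverse of `i` modulo `p` normalizes the eigenvalue to `1`.
  refine ⟨g i ^ (i : ZMod p)⁻¹.val, pow_ne_zero _ (right_ne_zero_of_mul hne), ?_⟩
  rw [Derivation.map_pow_of_eigen (hgi i hi)]
  have := congrArg (ZMod.castHom (dvd_refl p) K) (inv_mul_cancel₀ hi0)
  rw [map_mul, _root_.map_natCast, map_one] at this
  rw [← _root_.map_natCast (ZMod.castHom (dvd_refl p) K), ZMod.natCast_zmod_val, this, one_mul]

/-- With `δ x = x`, the powers `x ^ i` for `i < p` have distinct eigenvalues, hence are independent.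
They span because an element of eigenvalue `i` divided by `x ^ i` is a constant. -/
theorem Derivation.finrank_derivConst
    (h : aeval (derivEnd δ) (X ^ p - X : (derivConst δ)[X]) = 0) {d : K} (hd : δ d ≠ 0) :
    Module.finrank (derivConst δ) K = p := by
  obtain ⟨x, hx0, hx⟩ := Derivation.exists_eigenvector_one p h hd
  have hxn : ∀ n : ℕ, δ (x ^ n) = n * x ^ n := fun n => by
    rw [Derivation.map_pow_of_eigen (c := 1) (by rw [hx, one_mul]), mul_one]
  have hli : LinearIndependent (derivConst δ) (fun i : Fin p => x ^ (i : ℕ)) := by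
    refine Module.End.eigenvectors_linearIndependent' (derivEnd δ)
      (fun i : Fin p => ((i : ℕ) : derivConst δ)) ?_ _ fun i => ?_
    · intro i j hij
      exact Fin.ext (CharP.natCast_injOn_Iio (derivConst δ) p i.2 j.2 hij)
    · refine Module.End.hasEigenvector_iff.mpr ⟨Module.End.mem_eigenspace_iff.mpr ?_,
        pow_ne_zero _ hx0⟩
      rw [derivEnd_apply, hxn, Subfield.smul_def, smul_eq_mul, SubringClass.coe_natCast]
  have hsp : ⊤ ≤ Submodule.span (derivConst δ) (Set.range fun i : Fin p => x ^ (i : ℕ)) := by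
    intro a _
    obtain ⟨g, hg, hgi⟩ := Derivation.exists_eigen_decomposition p h a
    rw [hg]
    refine Submodule.sum_mem _ fun i hi => ?_
    have hc : δ (g i / x ^ i) = 0 := by
      rw [Derivation.leibniz_div, hgi i hi, hxn]
      simp only [smul_eq_mul]
      ring
    have : g i = (⟨_, hc⟩ : derivConst δ) • x ^ i := by
      rw [Subfield.smul_def, smul_eq_mul, div_mul_cancel₀ _ (pow_ne_zero _ hx0)]
    rw [this]
    exact Submodule.smul_mem _ _ (Submodule.subset_span ⟨⟨i, Finset.mem_range.mp hi⟩, rfl⟩)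
  rw [Module.finrank_eq_card_basis (Module.Basis.mk hli hsp), Fintype.card_fin]

end Derivation

/-! ### Commutation rules in `K[t;δ]` -/

namespace DiffPoly

section Basic

variable {K : Type u} [Field K] {δ : Derivation ℤ K K}

theorem toPoly_const (a : K) : toPoly (const δ a) = C a := rfl

theorem toPoly_const_mul (a : K) (u : DiffPoly δ) : toPoly (const δ a * u) = C a * toPoly u := by
  rw [← smul_eq_const_mul, map_smul, smul_eq_C_mul]

theorem toPoly_t : toPoly (t δ) = X := rfl

theorem toPoly_t_pow_mul (n : ℕ) (u : DiffPoly δ) :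
    toPoly (t δ ^ n * u) = (tMul δ ^ n) (toPoly u) := by
  induction n with
  | zero => simp
  | succ n ih =>
    rw [pow_succ', mul_assoc, toPoly_mul, ih, toPoly_t, ← monomial_one_one_eq_X, mulAux_monomial,
      C_1, one_mul, pow_one, pow_succ', Module.End.mul_apply]

theorem toPoly_t_pow (n : ℕ) : toPoly (t δ ^ n) = X ^ n := by
  rw [← mul_one (t δ ^ n), toPoly_t_pow_mul, toPoly_one, tMul_pow_one]

theorem degree_toPoly_mul (u v : DiffPoly δ) :
    (toPoly (u * v)).degree = (toPoly u).degree + (toPoly v).degree := by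
  rw [toPoly_mul, degree_mulAux]

theorem toPoly_eq_zero {u : DiffPoly δ} : toPoly u = 0 ↔ u = 0 := toPoly.map_eq_zero_iff

instance : NoZeroDivisors (DiffPoly δ) where
  eq_zero_or_eq_zero_of_mul_eq_zero {u v} h := by
    have h1 := degree_toPoly_mul u v
    rw [h, map_zero, degree_zero, eq_comm, WithBot.add_eq_bot, degree_eq_bot, degree_eq_bot,
      toPoly_eq_zero, toPoly_eq_zero] at h1
    exact h1

theorem const_ne_zero {a : K} (ha : a ≠ 0) : const δ a ≠ 0 := fun h =>
  ha (C_eq_zero.mp (toPoly_eq_zero.mpr h))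

theorem const_mul_const (a b : K) : const δ a * const δ b = const δ (a * b) := by
  apply toPoly.injective
  rw [toPoly_const_mul, toPoly_const, toPoly_const, C_mul]

theorem const_zero : const δ (0 : K) = 0 := by
  apply toPoly.injective
  rw [toPoly_const, C_0, map_zero]

theorem const_one : const δ (1 : K) = 1 := rfl

/-- The coefficients of `tⁿ c`, by the Leibniz rule. -/
theorem coeff_tMul_pow_C (n : ℕ) (c : K) (m : ℕ) :
    ((tMul δ ^ n) (C c)).coeff m = n.choose m * δ^[n - m] c := by
  induction n generalizing m with
  | zero => cases m <;> simp [coeff_C]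
  | succ n ih =>
    rw [pow_succ', Module.End.mul_apply, tMul_apply, coeff_add, coeff_coeffDeriv, ih]
    cases m with
    | zero => simp [Function.iterate_succ_apply']
    | succ m =>
      rw [coeff_X_mul, ih, Nat.choose_succ_succ, Derivation.leibniz, Derivation.map_natCast,
        smul_zero, add_zero, smul_eq_mul, ← Function.iterate_succ_apply' δ, Nat.succ_sub_succ]
      rcases lt_or_ge n (m + 1) with h | h
      · rw [Nat.choose_eq_zero_of_lt h]
        push_cast
        ring
      · rw [show (n - (m + 1)).succ = n - m by omega]
        push_cast
        ring

/-- In the Leibniz expansion of `t ^ p a` the inner binomial coefficients are divisible by `p`; only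
the two outer terms survive. -/
theorem t_pow_char_mul_const (p : ℕ) [Fact p.Prime] [CharP K p] (a : K) :
    t δ ^ p * const δ a = const δ a * t δ ^ p + const δ (δ^[p] a) := by
  have hp : p.Prime := Fact.out
  apply toPoly.injective
  rw [toPoly_t_pow_mul, map_add, toPoly_const_mul, toPoly_t_pow, toPoly_const, toPoly_const]
  ext m
  rw [coeff_tMul_pow_C, coeff_add, coeff_C_mul_X_pow, coeff_C]
  rcases Nat.eq_zero_or_pos m with rfl | hm
  · simp [hp.ne_zero.symm]
  rcases lt_trichotomy m p with h | rfl | h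
  · have : (p.choose m : K) = 0 :=
      (CharP.cast_eq_zero_iff K p _).mpr (hp.dvd_choose_self hm.ne' h)
    simp [this, hm.ne', h.ne]
  · simp [hm.ne']
  · simp [Nat.choose_eq_zero_of_lt h, hm.ne', h.ne']

/-- Shows that commutation with a nonconstant lowers the degree by exactly one as long as `k + 1` is
nonzero in `K`. Only the terms of degree `k` and `k + 1` of `u` reach the coefficient at `k`; the
former cancels since `K` is commutative. -/
theorem coeff_commutator (u : DiffPoly δ) (c : K) {k : ℕ} (hk : (toPoly u).natDegree = k + 1) :
    (toPoly (u * const δ c - const δ c * u)).coeff k =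
      (toPoly u).coeff (k + 1) * ((k + 1 : ℕ) * δ c) := by
  rw [map_sub, toPoly_const_mul, toPoly_mul, toPoly_const, coeff_sub, coeff_C_mul, mulAux,
    sum_over_range _ (by simp), hk, finsetSum_coeff, Finset.sum_range_succ, Finset.sum_range_succ,
    Finset.sum_eq_zero]
  · simp only [coeff_C_mul, coeff_tMul_pow_C]
    simp
    ring
  · intro i hi
    rw [coeff_C_mul, coeff_tMul_pow_C, Nat.choose_eq_zero_of_lt (Finset.mem_range.mp hi)]
    simp

theorem degree_commutator_lt {u : DiffPoly δ} (hu : u ≠ 0) {c : K} (hc : c ≠ 0) :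
    (toPoly (u * const δ c - const δ c * u)).degree < (toPoly u).degree := by
  have h := degree_mulAux_sub_lt δ (toPoly u) (C c) (fun h => hu (toPoly_eq_zero.mp h))
    (C_ne_zero.mpr hc)
  rw [degree_mul, degree_C hc, add_zero, mul_comm (toPoly u)] at h
  rwa [map_sub, toPoly_const_mul, toPoly_mul, toPoly_const]

end Basic

/-! ### The polynomials `t ^ p - t - d` -/

section ArtinSchreier

variable {K : Type u} [Field K] (δ : Derivation ℤ K K) (p : ℕ)

/-- The differential polynomial `t ^ p - t - d`. -/
noncomputable def artinSchreier (d : K) : DiffPoly δ := t δ ^ p - t δ - const δ d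

variable {δ p}

theorem degree_artinSchreier (hp : 1 < p) (d : K) :
    (toPoly (artinSchreier δ p d)).degree = p := by
  rw [artinSchreier, map_sub, map_sub, toPoly_t_pow, toPoly_t, toPoly_const, sub_sub,
    degree_sub_eq_left_of_degree_lt, degree_X_pow]
  rw [degree_X_pow, degree_X_add_C]
  exact_mod_cast hp

theorem natDegree_artinSchreier (hp : 1 < p) (d : K) : natDegree (artinSchreier δ p d) = p :=
  natDegree_eq_of_degree_eq_some (degree_artinSchreier hp d)

theorem artinSchreier_ne_zero (hp : 1 < p) (d : K) : artinSchreier δ p d ≠ 0 := by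
  intro h
  have := degree_artinSchreier (δ := δ) hp d
  rw [h, map_zero, degree_zero] at this
  exact WithBot.bot_ne_coe this

/-- Powers of `t` commute with `t`, so only `d` contributes. The term `δ(d)` is the obstruction to
associativity. -/
theorem artinSchreier_mul_t (d : K) :
    artinSchreier δ p d * t δ = t δ * artinSchreier δ p d + const δ (δ d) := by
  have h := t_mul_const δ d
  have h2 := pow_mul_comm' (t δ) p
  simp only [artinSchreier, sub_mul, mul_sub, h, h2]
  abel

variable [Fact p.Prime] [CharP K p]

/-- The commutators of `t ^ p` and of `t` with `a` are `δ^[p] a` and `δ a`, which cancel. -/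
theorem artinSchreier_mul_const (h : ∀ a, δ^[p] a = δ a) (d a : K) :
    artinSchreier δ p d * const δ a = const δ a * artinSchreier δ p d := by
  simp only [artinSchreier, sub_mul, mul_sub, t_mul_const, t_pow_char_mul_const, h,
    const_mul_const, mul_comm d a]
  abel

theorem commute_artinSchreier_zero (h : ∀ a, δ^[p] a = δ a) (u : DiffPoly δ) :
    Commute (artinSchreier δ p 0) u := by
  rw [eq_sum δ u]
  refine Commute.sum_right _ _ _ fun i _ => Commute.mul_right ?_ (Commute.pow_right ?_ _)
  · exact artinSchreier_mul_const h 0 _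
  · have := artinSchreier_mul_t (δ := δ) (p := p) 0
    rwa [map_zero, const_zero, add_zero] at this

/-- If `d` is not a constant then `t ^ p - t - d` generates a maximal left ideal. -/
theorem eq_top_of_artinSchreier_mem (h : ∀ a, δ^[p] a = δ a) {d : K} (hd : δ d ≠ 0)
    {I : Ideal (DiffPoly δ)} (hI : artinSchreier δ p d ∈ I) {w : DiffPoly δ} (hw : w ∈ I)
    (hw0 : w ≠ 0) (hdeg : (toPoly w).degree < p) : I = ⊤ := by
  have hd0 : d ≠ 0 := fun h0 => hd (by rw [h0, map_zero])
  -- Since `d = z - f` with `z = t ^ p - t` central, `v d = z v - v f`, and both terms lie in the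
  -- left ideal.
  have hmul : ∀ v ∈ I, v * const δ d ∈ I := by
    intro v hv
    have e : v * const δ d = artinSchreier δ p 0 * v - v * artinSchreier δ p d := by
      rw [(commute_artinSchreier_zero h v).eq, ← mul_sub]
      simp [artinSchreier, const_zero]
    rw [e]
    exact I.sub_mem (I.mul_mem_left _ hv) (I.mul_mem_left _ hI)
  -- Descent on the degree: replace `w` by its commutator with `d`, down to a nonzero constant,
  -- which is a unit.
  induction hn : (toPoly w).natDegree generalizing w with
  | zero =>
    have hC := eq_C_of_natDegree_eq_zero hn
    set a := (toPoly w).coeff 0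
    have ha : a ≠ 0 := by
      intro h0
      rw [h0, C_0] at hC
      exact hw0 (toPoly_eq_zero.mp hC)
    have e : w = const δ a := toPoly.injective hC
    rw [Ideal.eq_top_iff_one, ← const_one, ← inv_mul_cancel₀ ha, ← const_mul_const, ← e]
    exact I.mul_mem_left _ hw
  | succ k ih =>
    have hk : k + 1 < p := by
      rw [degree_eq_natDegree (fun h0 => hw0 (toPoly_eq_zero.mp h0)), hn] at hdeg
      exact_mod_cast hdeg
    have hlt := degree_commutator_lt hw0 hd0
    have hc : (toPoly (w * const δ d - const δ d * w)).coeff k ≠ 0 := by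
      rw [coeff_commutator w d hn]
      refine mul_ne_zero ?_ (mul_ne_zero ?_ hd)
      · rw [← hn]
        exact leadingCoeff_ne_zero.mpr fun h0 => hw0 (toPoly_eq_zero.mp h0)
      · rw [Ne, CharP.cast_eq_zero_iff K p]
        exact Nat.not_dvd_of_pos_of_lt k.succ_pos hk
    refine ih (w := w * const δ d - const δ d * w)
      (I.sub_mem (hmul w hw) (I.mul_mem_left _ hw)) ?_ (hlt.trans hdeg) ?_
    · intro h0
      rw [h0, map_zero, coeff_zero] at hc
      exact hc rfl
    · refine le_antisymm ?_ (le_natDegree_of_ne_zero hc)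
      rw [← Nat.lt_succ_iff, Nat.succ_eq_add_one, ← hn]
      refine natDegree_lt_natDegree ?_ hlt
      intro h0
      rw [h0, coeff_zero] at hc
      exact hc rfl

end ArtinSchreier

/-! ### The substitution `t ↦ t + 1` -/

section Shift

variable {K : Type u} [Field K] {δ : Derivation ℤ K K}

theorem coeffDeriv_C_mul (a : K) (g : K[X]) :
    coeffDeriv δ (C a * g) = C a * coeffDeriv δ g + C (δ a) * g := by
  ext n
  simp only [coeff_coeffDeriv, coeff_C_mul, coeff_add, Derivation.leibniz, smul_eq_mul]
  ring

theorem coeffDeriv_X_add_one_pow (n : ℕ) : coeffDeriv δ ((X + 1) ^ n) = 0 := by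
  ext m
  rw [coeff_coeffDeriv, coeff_X_add_one_pow, Derivation.map_natCast, coeff_zero]

theorem coeffDeriv_taylor_one (g : K[X]) :
    coeffDeriv δ (taylor 1 g) = taylor 1 (coeffDeriv δ g) := by
  induction g using Polynomial.induction_on' with
  | add g h hg hh => rw [map_add, map_add, hg, hh, map_add, map_add]
  | monomial n a =>
    have h : coeffDeriv δ (monomial n a) = monomial n (δ a) := by
      ext m
      rw [coeff_coeffDeriv, coeff_monomial, coeff_monomial]
      split_ifs <;> simp
    rw [h, taylor_monomial, taylor_monomial, C_1, coeffDeriv_C_mul, coeffDeriv_X_add_one_pow,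
      mul_zero, zero_add]

theorem taylor_one_tMul (g : K[X]) :
    taylor 1 (tMul δ g) = tMul δ (taylor 1 g) + taylor 1 g := by
  rw [tMul_apply, tMul_apply, map_add, taylor_mul, taylor_X, coeffDeriv_taylor_one, C_1]
  ring

/-- The element `t + 1` satisfies the same commutation rule with `K` as `t`, since `1` is central;
left linearity reduces the claim to powers of `t`. -/
theorem mulAux_taylor_one (g h : K[X]) :
    mulAux δ (taylor 1 g) (taylor 1 h) = taylor 1 (mulAux δ g h) := by
  have key : ∀ n, mulAux δ ((X + 1) ^ n) (taylor 1 h) = taylor 1 ((tMul δ ^ n) h) := by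
    intro n
    induction n with
    | zero => simp [mulAux_one_left]
    | succ n ih =>
      have e : (X + 1 : K[X]) ^ (n + 1) = tMul δ ((X + 1) ^ n) + (X + 1) ^ n := by
        rw [tMul_apply, coeffDeriv_X_add_one_pow]
        ring
      rw [e, mulAux_add_left, mulAux_tMul, ih, pow_succ', Module.End.mul_apply, taylor_one_tMul]
  induction g using Polynomial.induction_on' with
  | add g g' hg hg' => rw [map_add, mulAux_add_left, hg, hg', mulAux_add_left, map_add]
  | monomial n a =>
    rw [taylor_monomial, C_1, mulAux_C_mul, key, mulAux_monomial, taylor_mul, taylor_C]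

variable (δ)

/-- The left `K`-linear substitution `t ↦ t + c` in `K[t;δ]`. -/
noncomputable def shift (c : K) : DiffPoly δ →ₗ[K] DiffPoly δ :=
  toPoly.symm.toLinearMap ∘ₗ taylor c ∘ₗ toPoly.toLinearMap

variable {δ}

theorem toPoly_shift (c : K) (u : DiffPoly δ) : toPoly (shift δ c u) = taylor c (toPoly u) := rfl

theorem shift_shift (b c : K) (u : DiffPoly δ) : shift δ b (shift δ c u) = shift δ (b + c) u := by
  apply toPoly.injective
  simp only [toPoly_shift, taylor_taylor]

theorem shift_zero (u : DiffPoly δ) : shift δ 0 u = u := by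
  apply toPoly.injective
  rw [toPoly_shift, taylor_zero]

theorem shift_const (c a : K) : shift δ c (const δ a) = const δ a := by
  apply toPoly.injective
  rw [toPoly_shift, toPoly_const, taylor_C]

theorem shift_t : shift δ 1 (t δ) = t δ + 1 := by
  apply toPoly.injective
  rw [toPoly_shift, toPoly_t, taylor_X, map_add, toPoly_t, toPoly_one, C_1]

theorem shift_one_mul (u v : DiffPoly δ) : shift δ 1 (u * v) = shift δ 1 u * shift δ 1 v :=
  toPoly.injective (mulAux_taylor_one (toPoly u) (toPoly v)).symm

/-- In characteristic `p`, `(X + 1) ^ p = X ^ p + 1`, and the two ones cancel. -/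
theorem shift_one_artinSchreier (p : ℕ) [Fact p.Prime] [CharP K p] (d : K) :
    shift δ 1 (artinSchreier δ p d) = artinSchreier δ p d := by
  apply toPoly.injective
  simp only [toPoly_shift, artinSchreier, map_sub, toPoly_t_pow, toPoly_t, toPoly_const]
  rw [taylor_X_pow, taylor_X, taylor_C, C_1, add_pow_char, one_pow]
  ring

theorem shift_mem_degLT (c : K) {m : ℕ} {u : DiffPoly δ} (hu : u ∈ degLT δ m) :
    shift δ c u ∈ degLT δ m := by
  rw [mem_degLT] at hu ⊢
  rwa [toPoly_shift, degree_taylor]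

end Shift

end DiffPoly

/-! ### Petit algebras -/

namespace PetitAlgebra

open DiffPoly

section Basic

variable {K : Type u} [Field K] {δ : Derivation ℤ K K} {f : DiffPoly δ}

theorem mul_def (x y : PetitAlgebra f) : x * y = mk f (rep x * rep y) := rfl

theorem rep_injective : Function.Injective (rep : PetitAlgebra f → DiffPoly δ) :=
  Subtype.val_injective

theorem rep_mem (x : PetitAlgebra f) : rep x ∈ degLT δ (DiffPoly.natDegree f) := x.2

theorem rep_mk {u : DiffPoly δ} (hu : u ∈ degLT δ (DiffPoly.natDegree f)) : rep (mk f u) = u :=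
  congrArg Subtype.val (modr_coe f ⟨u, hu⟩)

theorem exists_eq_mul_add_rep_mk (hf : f ≠ 0) (u : DiffPoly δ) :
    ∃ q, u = q * f + rep (mk f u) := modr_spec f u hf

theorem mk_mul_self (q : DiffPoly δ) : mk f (q * f) = 0 := by
  by_cases hf : f = 0
  · rw [hf, mul_zero, map_zero]
  obtain ⟨q', h⟩ := modr_spec f (q * f) hf
  exact rem_unique hf h (q' := q) (r' := 0) (by simp)

theorem mk_eq_zero_iff (hf : f ≠ 0) {u : DiffPoly δ} : mk f u = 0 ↔ ∃ q, u = q * f := by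
  refine ⟨fun h => ?_, ?_⟩
  · obtain ⟨q, hq⟩ := exists_eq_mul_add_rep_mk hf u
    exact ⟨q, by rw [hq, h, map_zero, add_zero]⟩
  · rintro ⟨q, rfl⟩
    exact mk_mul_self q

theorem rep_ofField (hf : 0 < DiffPoly.natDegree f) (a : K) : rep (ofField f a) = const δ a := by
  refine rep_mk ?_
  rw [mem_degLT, toPoly_const]
  exact degree_C_le.trans_lt (by exact_mod_cast hf)

theorem smul_mul (a : K) (x y : PetitAlgebra f) : (a • x) * y = a • (x * y) := by
  rw [mul_def, mul_def, map_smul, smul_eq_const_mul, mul_assoc, ← smul_eq_const_mul, map_smul]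

/-- An element `a` of `F` commutes with `t` and with `K`, hence is central in `K[t;δ]`. -/
theorem mul_smul_of_mem (x : PetitAlgebra f) {a : K} (ha : a ∈ derivConst δ)
    (y : PetitAlgebra f) : x * (a • y) = a • (x * y) := by
  have hc : Commute (rep x) (const δ a) := by
    rw [eq_sum δ (rep x)]
    refine Commute.sum_left _ _ _ fun i _ => Commute.mul_left ?_ (Commute.pow_left ?_ _)
    · rw [Commute, SemiconjBy, const_mul_const, const_mul_const, mul_comm]
    · have := t_mul_const δ a
      rwa [mem_derivConst.mp ha, const_zero, add_zero] at this
  rw [mul_def, mul_def, map_smul, smul_eq_const_mul, ← mul_assoc, hc.eq, mul_assoc,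
    ← smul_eq_const_mul, map_smul]

instance : IsScalarTower (derivConst δ) (PetitAlgebra f) (PetitAlgebra f) where
  smul_assoc a x y := smul_mul (a : K) x y

instance : SMulCommClass (derivConst δ) (PetitAlgebra f) (PetitAlgebra f) where
  smul_comm a x y := (mul_smul_of_mem x a.2 y).symm

variable (δ) in
/-- Differential polynomials of degree less than `m` and their coefficients. -/
noncomputable def degLTEquiv (m : ℕ) : degLT δ m ≃ₗ[K] Fin m → K := degreeLTEquiv K m

instance finite_degLT (m : ℕ) : Module.Finite K (degLT δ m) :=
  Module.Finite.equiv (degLTEquiv δ m).symm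

theorem finrank_degLT (m : ℕ) : Module.finrank K (degLT δ m) = m := by
  rw [(degLTEquiv δ m).finrank_eq, Module.finrank_fin_fun]

instance : Module.Finite K (PetitAlgebra f) := finite_degLT (δ := δ) f.natDegree

theorem finrank_eq_natDegree : Module.finrank K (PetitAlgebra f) = DiffPoly.natDegree f :=
  finrank_degLT (δ := δ) f.natDegree

/-- If `q` annihilates the class of `u` modulo `K[t;δ]f`, then the left submodule generated by this
class has dimension at most `deg q`. -/
theorem natDegree_le_of_span_eq_top {q u v : DiffPoly δ} (hq : q ≠ 0) (h : q * u = v * f)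
    (htop : Ideal.span {u, f} = ⊤) : DiffPoly.natDegree f ≤ DiffPoly.natDegree q := by
  let φ : degLT δ (DiffPoly.natDegree q) →ₗ[K] PetitAlgebra f :=
    { toFun r := mk f (r * u)
      map_add' r s := by rw [Submodule.coe_add, add_mul, map_add]
      map_smul' a r := by
        rw [Submodule.coe_smul, smul_eq_const_mul, mul_assoc, ← smul_eq_const_mul, map_smul,
          RingHom.id_apply] }
  -- Write a representative as `a u + b f` and divide `a = s q + r`. As `q u` is a left multiple of
  -- `f`, the class is that of `r u`, with `deg r < deg q`.
  have hφ : Function.Surjective φ := by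
    intro y
    have hy : rep y ∈ Ideal.span {u, f} := htop ▸ Submodule.mem_top
    obtain ⟨a, b, hab⟩ := Ideal.mem_span_pair.mp hy
    obtain ⟨r, s, hrs⟩ := exists_rem q hq a
    refine ⟨r, ?_⟩
    change mk f (r * u) = y
    have e : (r : DiffPoly δ) * u = rep y - (s * v + b) * f := by
      rw [← hab, hrs, add_mul, add_mul, mul_assoc s q u, h, mul_assoc s v f]
      abel
    rw [e, map_sub, mk_rep, mk_mul_self, sub_zero]
  have := LinearMap.finrank_le_finrank_of_surjective hφ
  rwa [finrank_eq_natDegree, finrank_degLT] at this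

/-- Injective endomorphisms of a finite-dimensional space are surjective. The base field is `F`
because left multiplications need not be linear over `K`. -/
theorem isNonassocDivision_of_noZeroDivisors [FiniteDimensional (derivConst δ) (PetitAlgebra f)]
    [Nontrivial (PetitAlgebra f)]
    (h : ∀ x y : PetitAlgebra f, x * y = 0 → x = 0 ∨ y = 0) :
    IsNonassocDivision (PetitAlgebra f) := by
  refine ⟨inferInstance, fun a ha => ⟨?_, ?_⟩⟩
  · have hinj : Function.Injective (LinearMap.mulLeft (derivConst δ) a) :=
      (injective_iff_map_eq_zero _).mpr fun x hx => (h a x hx).resolve_left ha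
    exact ⟨hinj, LinearMap.injective_iff_surjective.mp hinj⟩
  · have hinj : Function.Injective (LinearMap.mulRight (derivConst δ) a) :=
      (injective_iff_map_eq_zero _).mpr fun x hx => (h x a hx).resolve_right ha
    exact ⟨hinj, LinearMap.injective_iff_surjective.mp hinj⟩

theorem range_ofField_subset_leftNucleus (hf : 0 < DiffPoly.natDegree f) :
    Set.range (ofField f) ⊆ leftNucleus (PetitAlgebra f) := by
  rintro _ ⟨a, rfl⟩ y z
  have h : ∀ y, ofField f a * y = a • y := fun y => by
    rw [mul_def, rep_ofField hf, ← smul_eq_const_mul, map_smul, mk_rep]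
  rw [h, h, smul_mul, sub_self]

theorem mul_const_mem_degLT {m : ℕ} {u : DiffPoly δ} (hu : u ∈ degLT δ m) (a : K) :
    u * const δ a ∈ degLT δ m := by
  rw [mem_degLT] at hu ⊢
  rw [degree_toPoly_mul, toPoly_const]
  refine lt_of_le_of_lt ?_ hu
  exact (add_le_add_right degree_C_le _).trans_eq (add_zero _)

/-- The product `y a` already has degree below `deg f`, so no reduction occurs before the last
factor, and both bracketings give the remainder of the associative product `y a z`. -/
theorem range_ofField_subset_middleNucleus (hf : 0 < DiffPoly.natDegree f) :
    Set.range (ofField f) ⊆ middleNucleus (PetitAlgebra f) := by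
  rintro _ ⟨a, rfl⟩ y z
  rw [mul_def y, rep_ofField hf, mul_def (mk f _), rep_mk (mul_const_mem_degLT (rep_mem y) a),
    mul_def _ z, rep_ofField hf, ← smul_eq_const_mul, map_smul, mk_rep, mul_def y, map_smul,
    smul_eq_const_mul, mul_assoc, sub_self]

/-- If `y z = q f + r`, then `q f a = q a f` still vanishes modulo `f`, so reducing before or after
multiplication by `a` makes no difference. -/
theorem range_ofField_subset_rightNucleus (hf : 0 < DiffPoly.natDegree f)
    (hcomm : ∀ a, f * const δ a = const δ a * f) :
    Set.range (ofField f) ⊆ rightNucleus (PetitAlgebra f) := by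
  rintro _ ⟨a, rfl⟩ y z
  have hf0 : f ≠ 0 := by
    rintro rfl
    simp [DiffPoly.natDegree] at hf
  obtain ⟨q, hq⟩ := exists_eq_mul_add_rep_mk hf0 (rep y * rep z)
  rw [mul_def z, rep_ofField hf, mul_def y (mk f _), rep_mk (mul_const_mem_degLT (rep_mem z) a),
    mul_def (y * z), rep_ofField hf, mul_def y z, ← mul_assoc]
  nth_rewrite 2 [hq]
  rw [add_mul, mul_assoc q, hcomm, ← mul_assoc, map_add, mk_mul_self, zero_add, sub_self]

end Basic

/-! ### The algebras `(K, δ, d)` -/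

section ArtinSchreier

variable {K : Type u} [Field K] {δ : Derivation ℤ K K} {p : ℕ} [Fact p.Prime] {d : K}

theorem natDegree_artinSchreier_pos : 0 < DiffPoly.natDegree (artinSchreier δ p d) := by
  have hp : 1 < p := (Fact.out : p.Prime).one_lt
  rw [natDegree_artinSchreier hp]
  omega

theorem rep_mem_degLT_char (x : PetitAlgebra (artinSchreier δ p d)) : rep x ∈ degLT δ p := by
  have h := rep_mem x
  rwa [natDegree_artinSchreier (Fact.out : p.Prime).one_lt] at h

theorem rep_mk_of_mem_degLT_char {u : DiffPoly δ} (hu : u ∈ degLT δ p) :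
    rep (mk (artinSchreier δ p d) u) = u :=
  rep_mk (by rwa [natDegree_artinSchreier (Fact.out : p.Prime).one_lt])

variable (δ p d) in
/-- The class of `t` in `(K, δ, d)`. -/
noncomputable def gen : PetitAlgebra (artinSchreier δ p d) := mk _ (t δ)

theorem rep_gen : rep (gen δ p d) = t δ := by
  refine rep_mk_of_mem_degLT_char ?_
  rw [mem_degLT, toPoly_t, degree_X]
  exact_mod_cast (Fact.out : p.Prime).one_lt

/-- If `x y = q f + r` in `K[t;δ]`, then `[x, y, t] = - q δ(d)`; so this associator vanishes only if
`deg x + deg y < p`. -/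
theorem degree_add_degree_lt_of_mul_gen (hd : δ d ≠ 0)
    {x y : PetitAlgebra (artinSchreier δ p d)}
    (h : (x * y) * gen δ p d - x * (y * gen δ p d) = 0) :
    (toPoly (rep x)).degree + (toPoly (rep y)).degree < p := by
  have hp : 1 < p := (Fact.out : p.Prime).one_lt
  have hf0 := artinSchreier_ne_zero (δ := δ) hp d
  obtain ⟨q, hq⟩ := exists_eq_mul_add_rep_mk hf0 (rep x * rep y)
  obtain ⟨q', hq'⟩ := exists_eq_mul_add_rep_mk hf0 (rep y * t δ)
  rw [← mul_def] at hq
  -- Here `r t = x y t - q f t`, and `f t = t f + δ(d)` leaves `- q δ(d)` modulo `f`.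
  have h1 : (x * y) * gen δ p d =
      mk _ (rep x * rep y * t δ) - mk _ (q * const δ (δ d)) := by
    have e : rep (x * y) * t δ =
        rep x * rep y * t δ - q * t δ * artinSchreier δ p d - q * const δ (δ d) := by
      rw [hq, add_mul, mul_assoc q, artinSchreier_mul_t, mul_add, mul_assoc q (t δ)]
      abel
    rw [mul_def (x * y), rep_gen, e, map_sub, map_sub, mk_mul_self, sub_zero]
  have h2 : x * (y * gen δ p d) = mk _ (rep x * rep y * t δ) := by
    have e : rep x * rep (y * gen δ p d) =
        rep x * rep y * t δ - rep x * q' * artinSchreier δ p d := by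
      rw [mul_def y, rep_gen, mul_assoc (rep x) (rep y), mul_assoc (rep x) q', ← mul_sub]
      nth_rewrite 2 [hq']
      rw [add_sub_cancel_left]
    rw [mul_def x, e, map_sub, mk_mul_self, sub_zero]
  rw [h1, h2, sub_sub_cancel_left, neg_eq_zero] at h
  -- Since `q f = x y - r` has degree below `2 p`, `deg q < p`. Thus `q δ(d)` is its own remainder,
  -- and a vanishing class means `q = 0`.
  have hqdeg : q ∈ degLT δ p := by
    have hlt : (toPoly (q * artinSchreier δ p d)).degree < (p : WithBot ℕ) + p := by
      have hx := mem_degLT.mp (rep_mem_degLT_char x)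
      have hy := mem_degLT.mp (rep_mem_degLT_char y)
      have hxy := mem_degLT.mp (rep_mem_degLT_char (x * y))
      rw [eq_sub_of_add_eq hq.symm, map_sub]
      refine (degree_sub_le _ _).trans_lt (max_lt ?_ (hxy.trans_le ?_))
      · rw [degree_toPoly_mul]
        exact (add_le_add_right hy.le _).trans_lt
          (WithBot.add_lt_add_right (WithBot.coe_ne_bot (a := p)) hx)
      · exact_mod_cast Nat.le_add_left p p
    rw [degree_toPoly_mul, degree_artinSchreier hp] at hlt
    exact mem_degLT.mpr (lt_of_add_lt_add_right hlt)
  have hz := rep_mk_of_mem_degLT_char (d := d) (mul_const_mem_degLT hqdeg (δ d))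
  rw [h, map_zero, eq_comm, mul_eq_zero, or_iff_left (const_ne_zero hd)] at hz
  rw [hz, zero_mul, zero_add] at hq
  rw [← degree_toPoly_mul, hq]
  exact mem_degLT.mp (rep_mem_degLT_char _)

theorem rep_gen_pow : rep (mk (artinSchreier δ p d) (t δ ^ (p - 1))) = t δ ^ (p - 1) := by
  refine rep_mk_of_mem_degLT_char ?_
  rw [mem_degLT, toPoly_t_pow, degree_X_pow]
  exact_mod_cast Nat.sub_lt (Fact.out : p.Prime).pos one_pos

theorem mem_range_ofField_of_degree_add_lt {x : PetitAlgebra (artinSchreier δ p d)}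
    (h : (toPoly (rep x)).degree + ((p - 1 : ℕ) : WithBot ℕ) < p) :
    x ∈ Set.range (ofField (artinSchreier δ p d)) := by
  refine ⟨(toPoly (rep x)).coeff 0, rep_injective (toPoly.injective ?_)⟩
  rw [rep_ofField natDegree_artinSchreier_pos, toPoly_const]
  refine (eq_C_of_degree_le_zero ?_).symm
  by_cases h0 : toPoly (rep x) = 0
  · simp [h0]
  · rw [degree_eq_natDegree h0] at h ⊢
    have hp : 0 < p := (Fact.out : p.Prime).pos
    norm_cast at h ⊢
    omega

/-- The element `t ^ (p - 1)` has the largest degree available, so the degree bound leaves no room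
for `x` beyond degree `0`. -/
theorem leftNucleus_subset (hd : δ d ≠ 0) :
    leftNucleus (PetitAlgebra (artinSchreier δ p d)) ⊆ Set.range (ofField _) := by
  intro x hx
  have h := degree_add_degree_lt_of_mul_gen hd (hx (mk _ (t δ ^ (p - 1))) (gen δ p d))
  rw [rep_gen_pow, toPoly_t_pow, degree_X_pow] at h
  exact mem_range_ofField_of_degree_add_lt h

theorem middleNucleus_subset (hd : δ d ≠ 0) :
    middleNucleus (PetitAlgebra (artinSchreier δ p d)) ⊆ Set.range (ofField _) := by
  intro x hx
  have h := degree_add_degree_lt_of_mul_gen hd (hx (mk _ (t δ ^ (p - 1))) (gen δ p d))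
  rw [rep_gen_pow, toPoly_t_pow, degree_X_pow, add_comm] at h
  exact mem_range_ofField_of_degree_add_lt h

theorem gen_notMem_range_ofField :
    gen δ p d ∉ Set.range (ofField (artinSchreier δ p d)) := by
  rintro ⟨a, ha⟩
  have h := congrArg (fun x => (toPoly (rep x)).coeff 1) ha
  simp only [rep_ofField natDegree_artinSchreier_pos, rep_gen, toPoly_const, toPoly_t] at h
  simp at h

theorem exists_mul_mul_ne (hd : δ d ≠ 0) :
    ∃ x y z : PetitAlgebra (artinSchreier δ p d), (x * y) * z ≠ x * (y * z) := by
  by_contra! h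
  exact gen_notMem_range_ofField
    (leftNucleus_subset hd fun y z => sub_eq_zero.mpr (h (gen δ p d) y z))

variable [CharP K p]

theorem eq_zero_or_eq_zero_of_mul_eq_zero (h : ∀ a, δ^[p] a = δ a) (hd : δ d ≠ 0)
    (x y : PetitAlgebra (artinSchreier δ p d)) (hxy : x * y = 0) : x = 0 ∨ y = 0 := by
  have hp : 1 < p := (Fact.out : p.Prime).one_lt
  obtain ⟨v, hv⟩ := (mk_eq_zero_iff (artinSchreier_ne_zero hp d)).mp hxy
  by_contra! hne
  have hx : rep x ≠ 0 := fun h0 => hne.1 (rep_injective (h0.trans (map_zero _).symm))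
  have hy : rep y ≠ 0 := fun h0 => hne.2 (rep_injective (h0.trans (map_zero _).symm))
  -- The class of `y` generates the quotient, of dimension `p`, while `x` annihilates it with `deg x
  -- < p`.
  have htop : Ideal.span {rep y, artinSchreier δ p d} = ⊤ :=
    eq_top_of_artinSchreier_mem h hd (Ideal.subset_span (by simp))
      (Ideal.subset_span (by simp)) hy (mem_degLT.mp (rep_mem_degLT_char y))
  have hle := natDegree_le_of_span_eq_top hx hv htop
  rw [natDegree_artinSchreier hp] at hle
  have hlt := mem_degLT.mp (rep_mem_degLT_char x)
  rw [degree_eq_natDegree fun h0 => hx (toPoly_eq_zero.mp h0)] at hlt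
  exact absurd hle (not_le.mpr (by exact_mod_cast hlt))

theorem finrank_derivConst_artinSchreier
    (h : aeval (derivEnd δ) (X ^ p - X : (derivConst δ)[X]) = 0) (hd : δ d ≠ 0) :
    Module.finrank (derivConst δ) (PetitAlgebra (artinSchreier δ p d)) = p ^ 2 := by
  rw [← Module.finrank_mul_finrank (derivConst δ) K, finrank_eq_natDegree,
    natDegree_artinSchreier (Fact.out : p.Prime).one_lt, Derivation.finrank_derivConst p h hd, sq]

end ArtinSchreier

/-! ### Automorphisms induced by `t ↦ t + 1` -/

section Shift

variable {K : Type u} [Field K] {δ : Derivation ℤ K K} {f : DiffPoly δ}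

variable (f) in
/-- The substitution `t ↦ t + c` on representatives. -/
noncomputable def shiftLinear (c : K) : PetitAlgebra f →ₗ[K] PetitAlgebra f := mk f ∘ₗ shift δ c ∘ₗ rep

theorem rep_shiftLinear (c : K) (x : PetitAlgebra f) :
    rep (shiftLinear f c x) = shift δ c (rep x) :=
  rep_mk (shift_mem_degLT c (rep_mem x))

theorem shiftLinear_shiftLinear (b c : K) (x : PetitAlgebra f) :
    shiftLinear f b (shiftLinear f c x) = shiftLinear f (b + c) x := by
  apply rep_injective
  simp only [rep_shiftLinear, shift_shift]

theorem shiftLinear_zero (x : PetitAlgebra f) : shiftLinear f 0 x = x := by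
  apply rep_injective
  rw [rep_shiftLinear, shift_zero]

theorem shiftLinear_ofField (hf : 0 < DiffPoly.natDegree f) (c a : K) :
    shiftLinear f c (ofField f a) = ofField f a := by
  apply rep_injective
  rw [rep_shiftLinear, rep_ofField hf, shift_const]

/-- Applying the substitution to `x y = q f + r` gives another division by `f`, whose remainder is
the image of `r`. -/
theorem shiftLinear_one_mul (hf0 : f ≠ 0) (hf : shift δ 1 f = f) (x y : PetitAlgebra f) :
    shiftLinear f 1 (x * y) = shiftLinear f 1 x * shiftLinear f 1 y := by
  obtain ⟨q, hq⟩ := exists_eq_mul_add_rep_mk hf0 (rep x * rep y)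
  rw [← mul_def] at hq
  rw [mul_def (shiftLinear f 1 x), rep_shiftLinear, rep_shiftLinear, ← shift_one_mul, hq, map_add,
    shift_one_mul, hf, map_add, mk_mul_self, zero_add]
  rfl

variable (f) in
/-- The `F`-linear bijection induced by `t ↦ t + c`. -/
noncomputable def shiftEquiv (c : K) : PetitAlgebra f ≃ₗ[derivConst δ] PetitAlgebra f :=
  LinearEquiv.ofLinearMap ((shiftLinear f c).restrictScalars (derivConst δ))
    ((shiftLinear f (-c)).restrictScalars (derivConst δ))
    (LinearMap.ext fun x => by
      simp [shiftLinear_shiftLinear, shiftLinear_zero])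
    (LinearMap.ext fun x => by
      simp [shiftLinear_shiftLinear, shiftLinear_zero])

theorem shiftEquiv_apply (c : K) (x : PetitAlgebra f) : shiftEquiv f c x = shiftLinear f c x := rfl

theorem shiftEquiv_one_pow (n : ℕ) : shiftEquiv f 1 ^ n = shiftEquiv f (n : K) := by
  induction n with
  | zero => exact LinearEquiv.ext fun x => by simp [shiftEquiv_apply, shiftLinear_zero]
  | succ n ih =>
    refine LinearEquiv.ext fun x => ?_
    rw [pow_succ', ih, LinearEquiv.mul_apply]
    simp only [shiftEquiv_apply, shiftLinear_shiftLinear]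
    rw [Nat.cast_succ, add_comm]

theorem exists_cyclic_subgroup_nonassocAut {p : ℕ} [Fact p.Prime] [CharP K p] (d : K) :
    ∃ G : Subgroup (nonassocAut (derivConst δ) (PetitAlgebra (artinSchreier δ p d))),
      IsCyclic G ∧ Nat.card G = p ∧
      ∀ φ ∈ G, ∀ a : K, (φ : PetitAlgebra (artinSchreier δ p d) ≃ₗ[derivConst δ]
        PetitAlgebra (artinSchreier δ p d)) (ofField _ a) = ofField _ a := by
  have hp : 1 < p := (Fact.out : p.Prime).one_lt
  let σ : nonassocAut (derivConst δ) (PetitAlgebra (artinSchreier δ p d)) :=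
    ⟨shiftEquiv _ 1, shiftLinear_one_mul (artinSchreier_ne_zero hp d)
      (shift_one_artinSchreier p d)⟩
  have hσ : orderOf σ = p := by
    refine orderOf_eq_prime ?_ ?_
    · apply Subtype.ext
      rw [Subgroup.coe_pow, Subgroup.coe_one, shiftEquiv_one_pow, CharP.cast_eq_zero]
      exact LinearEquiv.ext shiftLinear_zero
    -- The substitution is not the identity: it sends `t` to `t + 1`.
    · intro h
      have h1 : shiftLinear (artinSchreier δ p d) 1 (gen δ p d) = gen δ p d :=
        LinearEquiv.congr_fun (congrArg Subtype.val h) _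
      have h2 := congrArg rep h1
      rw [rep_shiftLinear, rep_gen, shift_t, add_eq_left, ← const_one] at h2
      exact const_ne_zero one_ne_zero h2
  refine ⟨Subgroup.zpowers σ, inferInstance, by rw [Nat.card_zpowers, hσ], ?_⟩
  intro φ hφ a
  -- Finite order allows every element of the group to be written as a natural power of `σ`, that
  -- is, as the substitution `t ↦ t + n`.
  have hfo : IsOfFinOrder σ := orderOf_pos_iff.mp (hσ.symm ▸ hp.pos)
  obtain ⟨n, rfl⟩ := (hfo.mem_powers_iff_mem_zpowers.mpr hφ : φ ∈ Submonoid.powers σ)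
  change (σ ^ n).1 _ = _
  rw [Subgroup.coe_pow, shiftEquiv_one_pow, shiftEquiv_apply,
    shiftLinear_ofField natDegree_artinSchreier_pos]

end Shift

end PetitAlgebra

theorem mainTheorem1 {K : Type u} [Field K] (p : ℕ) [Fact p.Prime] [CharP K p]
    (δ : Derivation ℤ K K)
    (hδ : minpoly (derivConst δ) (derivEnd δ) = (X ^ p - X : (derivConst δ)[X]))
    (d : K) (hd : d ∉ derivConst δ)
    (f : DiffPoly δ) (hf : f = DiffPoly.t δ ^ p - DiffPoly.t δ - DiffPoly.const δ d) :
    -- the multiplication of the unital ring `S_f` is bilinear over `F = Const(δ)`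
    IsScalarTower (derivConst δ) (PetitAlgebra f) (PetitAlgebra f) ∧
    SMulCommClass (derivConst δ) (PetitAlgebra f) (PetitAlgebra f) ∧
    -- `S_f` is a division algebra of dimension `p ^ 2` that is not associative
    IsNonassocDivision (PetitAlgebra f) ∧
    (∃ x y z : PetitAlgebra f, (x * y) * z ≠ x * (y * z)) ∧
    Module.finrank (derivConst δ) (PetitAlgebra f) = p ^ 2 ∧
    -- the nuclei
    leftNucleus (PetitAlgebra f) = Set.range (PetitAlgebra.ofField f) ∧
    middleNucleus (PetitAlgebra f) = Set.range (PetitAlgebra.ofField f) ∧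
    Set.range (PetitAlgebra.ofField f) ⊆ rightNucleus (PetitAlgebra f) ∧
    -- a cyclic group of order `p` of `F`-algebra automorphisms that fix `K` elementwise
    ∃ G : Subgroup (nonassocAut (derivConst δ) (PetitAlgebra f)),
      IsCyclic G ∧ Nat.card G = p ∧
      ∀ φ ∈ G, ∀ a : K, (φ : PetitAlgebra f ≃ₗ[derivConst δ] PetitAlgebra f)
        (PetitAlgebra.ofField f a) = PetitAlgebra.ofField f a := by
  obtain rfl : f = DiffPoly.artinSchreier δ p d := hf
  have h0 : aeval (derivEnd δ) (X ^ p - X : (derivConst δ)[X]) = 0 := hδ ▸ minpoly.aeval _ _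
  have hit := Derivation.iterate_eq_of_aeval_derivEnd h0
  have hd' : δ d ≠ 0 := hd
  have hpos := PetitAlgebra.natDegree_artinSchreier_pos (δ := δ) (p := p) (d := d)
  have hrank := PetitAlgebra.finrank_derivConst_artinSchreier h0 hd'
  have hrpos : 0 < Module.finrank (derivConst δ)
      (PetitAlgebra (DiffPoly.artinSchreier δ p d)) := by
    rw [hrank]
    exact pow_pos (Fact.out : p.Prime).pos 2
  -- A positive `finrank` already gives both finite dimension and nontriviality, since `finrank` is
  -- `0` by convention in infinite dimension.
  have := Module.finite_of_finrank_pos hrpos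
  have := Module.nontrivial_of_finrank_pos hrpos
  refine ⟨inferInstance, inferInstance,
    PetitAlgebra.isNonassocDivision_of_noZeroDivisors
      (PetitAlgebra.eq_zero_or_eq_zero_of_mul_eq_zero hit hd'),
    PetitAlgebra.exists_mul_mul_ne hd', hrank,
    (PetitAlgebra.leftNucleus_subset hd').antisymm
      (PetitAlgebra.range_ofField_subset_leftNucleus hpos),
    (PetitAlgebra.middleNucleus_subset hd').antisymm
      (PetitAlgebra.range_ofField_subset_middleNucleus hpos),
    PetitAlgebra.range_ofField_subset_rightNucleus hpos
      (DiffPoly.artinSchreier_mul_const hit d),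
    PetitAlgebra.exists_cyclic_subgroup_nonassocAut d⟩
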